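/- Let $\Lambda$ be a discrete valuation ring with maximal ideal $(p)$. An embedding $(A\subset B)$ consists of a $\Lambda$-module $B$ of finite length and a submodule $A\subset B$; it is called cyclic if $A$ is a cyclic $\Lambda$-module. The direct sum of embeddings is $\bigoplus_k (A_k\subset B_k)=(\bigoplus_k A_k\subset\bigoplus_k B_k)$, and an isomorphism $(A\subset B)\cong(A'\subset B')$ is an isomorphism $B\to B'$ of modules which maps $A$ onto $A'$. A direct sum of cyclic embeddings is an embedding isomorphic to a finite direct sum of cyclic embeddings. A tableau $\Gamma=[\gamma^{(0)},\ldots,\gamma^{(r)}]$ is a chain of partitions $\gamma^{(0)}\subset\cdots\subset\gamma^{(r)}$ (with $\gamma^{(i)}=\gamma^{(r)}$ for $i\ge r$, and tableaux identified if they agree for all $i\geq 0$); it is pictured as the Young diagram of $\gamma^{(r)}$, with the parts of the partition drawn as the columns, in which each box of $\gamma^{(e)}\setminus\gamma^{(e-1)}$ carries the entry $e$ ($e\ge 1$), while the boxes of $\gamma^{(0)}$ are empty. It is a Littlewood-Richardson (LR) tableau if in each row the entries are weakly increasing, in each column the entries are strictly increasing, and to the right of each vertical line there are at least as many entries $e$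 as entries $e+1$ ($e=1,2,\ldots$). The tableau of an embedding $(A\subset B)$ is the tableau for which $\gamma^{(i)}$ lists the lengths of the indecomposable direct summands of $B/p^iA$, that is, $B/p^iA\cong\bigoplus_j\Lambda/(p^{\gamma^{(i)}_j})$, for all $i\ge 0$. A column is a tableau with at most one column, whose entries are subsequent natural numbers $e,e+1,\ldots,f$ at the bottom of the column (not necessarily starting at $1$; columns without entries are allowed). The union of finitely many tableaux is formed by taking, for each $i$, the union of the partitions $\gamma^{(i)}$ as multisets of parts. Lemma. An LR-tableau $\Gamma$ is the tableau of a direct sum of cyclic embeddings if and only if $\Gamma$ is a union of columns. -/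

import Mathlib

universe u

namespace LRCyclic

/-! ## Tableaux

Young diagrams are pictured with the parts of the partition as *columns*: the partition
`(γ₁ ≥ γ₂ ≥ ⋯)` is the diagram whose `j`-th column has length `γ_j`.  A cell `(i, j)` of a
`YoungDiagram` lies in row `i` and column `j`. -/

/-- The partition given by a Young diagram: the multiset of the lengths of its (nonempty)
columns. -/
def parts (μ : YoungDiagram) : Multiset ℕ :=
  (Multiset.range (μ.rowLen 0)).map μ.colLen

/-- A tableau `[γ⁽⁰⁾, γ⁽¹⁾, …, γ⁽ʳ⁾]`, that is, an increasing chain of partitions, extended by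
`γ⁽ⁱ⁾ = γ⁽ʳ⁾` for `i ≥ r` (so tableaux which have the same picture are equal). -/
@[ext]
structure Tableau where
  diagram : ℕ → YoungDiagram
  mono : Monotone diagram
  stable : ∃ r, ∀ i, r ≤ i → diagram i = diagram r

namespace Tableau

/-- The boxes which carry the entry `e ≥ 1`, i.e. the skew diagram `γ⁽ᵉ⁾ \ γ⁽ᵉ⁻¹⁾`
(no box carries the entry `0`). -/
def boxes (Γ : Tableau) (e : ℕ) : Finset (ℕ × ℕ) :=
  (Γ.diagram e).cells \ (Γ.diagram (e - 1)).cells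

/-- The Littlewood-Richardson condition. -/
structure IsLR (Γ : Tableau) : Prop where
  /-- In each row, the entries are weakly increasing. -/
  row_weak : ∀ i j j' e e', (i, j) ∈ Γ.boxes e → (i, j') ∈ Γ.boxes e' → j ≤ j' → e ≤ e'
  /-- In each column, the entries are strictly increasing. -/
  col_strict : ∀ i i' j e e', (i, j) ∈ Γ.boxes e → (i', j) ∈ Γ.boxes e' → i < i' → e < e'
  /-- The lattice permutation property: to the right of each vertical line there are at least
  as many entries `e` as there are entries `e + 1`. -/
  lattice : ∀ c e, 1 ≤ e →
    ((Γ.boxes (e + 1)).filter fun b => c ≤ b.2).card ≤ ((Γ.boxes e).filter fun b => c ≤ b.2).card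

end Tableau

/-- The Young diagram which consists of one column of height `n`. -/
def columnDiagram (n : ℕ) : YoungDiagram where
  cells := Finset.range n ×ˢ {0}
  isLowerSet := by
    rintro ⟨i, j⟩ ⟨i', j'⟩ h hm
    obtain ⟨h1, h2⟩ := Prod.mk_le_mk.mp h
    simp only [Finset.coe_product, Finset.coe_range, Finset.coe_singleton, Set.mem_prod,
      Set.mem_Iio, Set.mem_singleton_iff] at hm ⊢
    omega

theorem columnDiagram_mono : Monotone columnDiagram := by
  intro m n h
  change (columnDiagram m).cells ⊆ (columnDiagram n).cells
  exact Finset.product_subset_product (Finset.range_subset_range.mpr h) (Finset.Subset.refl _)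

/-- The one-column tableau `C(e,f)_n` of height `n` with entries `e, …, f` at the bottom: the
height of `γ⁽ⁱ⁾` is `n - f + e - 1` for `i ≤ e - 1`, it is `n - f + i` for `e - 1 ≤ i ≤ f`, and
`n` for `i ≥ f`.  It is used only for `1 ≤ e ≤ f` and `f - e + 1 ≤ n`, or for `e = 1`, `f = 0`
(the empty column `C(1,0)_n`). -/
def column (e f n : ℕ) : Tableau where
  diagram i := columnDiagram (n - (f - max i (e - 1)))
  mono := by
    intro i i' h
    apply columnDiagram_mono
    omega
  stable := ⟨f, fun i hi => by
    have h1 : f - max i (e - 1) = 0 := by omega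
    have h2 : f - max f (e - 1) = 0 := by omega
    simp only [h1, h2]⟩

namespace Tableau

/-- `Γ` is a column `C(e,f)_n` with `1 ≤ e ≤ f` (nonempty) or an empty column `C(1,0)_n`. -/
def IsColumn (Γ : Tableau) : Prop :=
  ∃ e f n : ℕ, ((1 ≤ e ∧ e ≤ f ∧ f + 1 ≤ n + e) ∨ (e = 1 ∧ f = 0)) ∧ Γ = column e f n

/-- `Γ` is the union of the finite family `C` of tableaux: for each `i`, the partition `γ⁽ⁱ⁾`
is the union, as a multiset of parts, of the corresponding partitions of the members. -/
def IsUnion {n : ℕ} (Γ : Tableau) (C : Fin n → Tableau) : Prop :=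
  ∀ i, parts (Γ.diagram i) = ∑ k, parts ((C k).diagram i)

/-- `Γ` is a (finite) union of columns with subsequent entries. -/
def IsUnionOfColumns (Γ : Tableau) : Prop :=
  ∃ (n : ℕ) (C : Fin n → Tableau), (∀ k, (C k).IsColumn) ∧ Γ.IsUnion C

end Tableau

/-! ## Embeddings -/

/-- An embedding `(A ⊂ B)` of a submodule in a finite length module over `Λ`. -/
structure Embedding (Λ : Type u) [CommRing Λ] where
  /-- the ambient module `B` -/
  ambient : Type u
  [addCommGroup : AddCommGroup ambient]
  [module : Module Λ ambient]
  finiteLength : IsFiniteLength Λ ambient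
  /-- the submodule `A` -/
  sub : Submodule Λ ambient

attribute [instance] Embedding.addCommGroup Embedding.module

namespace Embedding

variable {Λ : Type u} [CommRing Λ]

/-- Isomorphism of embeddings: an isomorphism of the ambient modules which carries the one
submodule onto the other. -/
def Iso (E F : Embedding Λ) : Prop :=
  ∃ φ : E.ambient ≃ₗ[Λ] F.ambient, E.sub.map (φ : E.ambient →ₗ[Λ] F.ambient) = F.sub

/-- The embedding `(A ⊂ B)` is cyclic if `A` is a cyclic module. -/
def IsCyclic (E : Embedding Λ) : Prop :=
  ∃ a : E.ambient, E.sub = Submodule.span Λ {a}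

/-- The direct sum `⨁ₖ (Aₖ ⊂ Bₖ) = (⨁ₖ Aₖ ⊂ ⨁ₖ Bₖ)` of a finite family of embeddings. -/
def directSum {n : ℕ} (F : Fin n → Embedding Λ) : Embedding Λ where
  ambient := ∀ k, (F k).ambient
  finiteLength := by
    have h := fun k => isFiniteLength_iff_isNoetherian_isArtinian.mp (F k).finiteLength
    have : ∀ k, IsNoetherian Λ (F k).ambient := fun k => (h k).1
    have : ∀ k, IsArtinian Λ (F k).ambient := fun k => (h k).2
    exact isFiniteLength_iff_isNoetherian_isArtinian.mpr ⟨inferInstance, inferInstance⟩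
  sub := Submodule.pi Set.univ fun k => (F k).sub

/-- The embedding is (isomorphic to) a finite direct sum of cyclic embeddings. -/
def IsDirectSumOfCyclics (E : Embedding Λ) : Prop :=
  ∃ (n : ℕ) (F : Fin n → Embedding Λ), (∀ k, (F k).IsCyclic) ∧ E.Iso (directSum F)

end Embedding

/-- `M ≅ N_μ = ⨁ⱼ Λ / (p ^ μⱼ)`, where `μⱼ` is the length of the `j`-th column and `(p)` is the
maximal ideal of `Λ`. -/
def HasType (Λ : Type u) [CommRing Λ] [IsLocalRing Λ] (M : Type u) [AddCommGroup M] [Module Λ M]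
    (μ : YoungDiagram) : Prop :=
  Nonempty (M ≃ₗ[Λ] ∀ j : Fin (μ.rowLen 0), Λ ⧸ IsLocalRing.maximalIdeal Λ ^ μ.colLen j)

/-- `Γ` is the tableau of the embedding `(A ⊂ B)`: for each `i`, the partition `γ⁽ⁱ⁾` records the
lengths of the indecomposable summands of `B / pⁱA`. -/
def Embedding.HasTableau {Λ : Type u} [CommRing Λ] [IsLocalRing Λ] (E : Embedding Λ)
    (Γ : Tableau) : Prop :=
  ∀ i, HasType Λ (E.ambient ⧸ (IsLocalRing.maximalIdeal Λ ^ i • E.sub)) (Γ.diagram i)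

end LRCyclic

namespace LRCyclic

open IsLocalRing

/-! ### Modules which are products of cyclic modules `R ⧸ I ^ n` -/

/-! The direct sum of embeddings corresponds to the union of tableaux
(`Embedding.hasParts_directSum`), and the nonzero parts of a finite length module are determined by
the lengths of its truncations `M ⧸ p ^ k M` (`HasParts.unique`). So the question is which unions of
columns arise from cyclic embeddings.

Let `a = (u_j p ^ h_j)_j` generate a submodule of `⨁ R ⧸ (p ^ n_j)`, with units `u_j`. Take `t` with
`h = h_t` least and put `f = n_t - h`. Then `a = p ^ h • (1, b)` up to a unit, and eliminating one
relation shows that the quotient by `p ^ i • a` is a summand of length `h + min i f` plus the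
quotient of the remaining factors by `p ^ (max i f + h) • b` (`HasParts.cons`). The first part is a
column with entries `1, …, f`; the rest is the same problem with the clock starting at `f`.
Induction on the number of summands yields a union of columns (`exists_columns_of_cyclic`).

Conversely, the step can be reversed: columns in which each starts with the entry after the end of
its predecessor, and in which `n - f` is weakly increasing, assemble to one cyclic embedding
(`exists_cyclic_of_chain`). It remains to distribute the columns of an LR-tableau into such chains,
each beginning with a column that starts with `1` or is empty. Rewritten in terms of rows, the
lattice condition bounds the number of columns starting with `e + 1` above a given row by the number
of columns ending with `e` above the preceding row (`card_start_le_card_end`). This is Hall's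
condition for choosing predecessors injectively (`exists_pred`). -/

/-- `M` is isomorphic to the product of the modules `R ⧸ I ^ n`, for `n` in the multiset `s`. -/
def HasParts {R : Type*} [CommRing R] (I : Ideal R) (M : Type*) [AddCommGroup M] [Module R M]
    (s : Multiset ℕ) : Prop :=
  ∃ (ι : Type) (_ : Fintype ι) (n : ι → ℕ), Finset.univ.val.map n = s ∧
    Nonempty (M ≃ₗ[R] ∀ j, R ⧸ I ^ n j)

/-- Families with the same multiset of values differ by a bijection of the index types. -/
theorem exists_equiv_of_map_univ_eq {α β γ : Type*} [Fintype α] [Fintype β] {f : α → γ} {g : β → γ}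
    (h : Finset.univ.val.map f = Finset.univ.val.map g) : ∃ e : α ≃ β, ∀ a, g (e a) = f a := by
  classical
  have key : ∀ c, Nonempty ({a // f a = c} ≃ {b // g b = c}) := by
    intro c
    refine ⟨Fintype.equivOfCardEq ?_⟩
    have h' := congrArg (Multiset.count c) h
    rw [Multiset.count_map, Multiset.count_map] at h'
    rw [Fintype.card_subtype, Fintype.card_subtype]
    simpa [Finset.card_def, Finset.filter_val, eq_comm] using h'
  exact ⟨Equiv.ofFiberEquiv fun c => (key c).some, fun a => Equiv.ofFiberEquiv_map _ a⟩

theorem map_univ_val_eq_sum {α β : Type*} [Fintype α] (f : α → β) :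
    Finset.univ.val.map f = ∑ a, ({f a} : Multiset β) := by
  rw [Finset.sum_eq_multiset_sum, ← Multiset.sum_map_singleton (Finset.univ.val.map f),
    Multiset.map_map]
  rfl

/-- Splitting off one factor of a product of modules. -/
def piSplitAtLinear {ι : Type*} [DecidableEq ι] (R : Type*) [Semiring R] (t : ι) (β : ι → Type*)
    [∀ i, AddCommMonoid (β i)] [∀ i, Module R (β i)] :
    (∀ j, β j) ≃ₗ[R] β t × ∀ j : {j // j ≠ t}, β j :=
  { Equiv.piSplitAt t β with
    map_add' := fun _ _ => rfl
    map_smul' := fun _ _ => rfl }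

section HasParts

variable {R : Type*} [CommRing R] {I : Ideal R}
  {M : Type*} [AddCommGroup M] [Module R M] {N : Type*} [AddCommGroup N] [Module R N]
  {s t : Multiset ℕ}

theorem HasParts.congr (h : HasParts I M s) (e : M ≃ₗ[R] N) : HasParts I N s := by
  obtain ⟨ι, _, n, hs, ⟨f⟩⟩ := h
  exact ⟨ι, _, n, hs, ⟨e.symm.trans f⟩⟩

theorem hasParts_quotient_pow (I : Ideal R) (n : ℕ) : HasParts I (R ⧸ I ^ n) {n} :=
  ⟨Unit, inferInstance, fun _ => n, by simp, ⟨(LinearEquiv.funUnique Unit R _).symm⟩⟩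

theorem hasParts_zero [Subsingleton M] : HasParts I M 0 :=
  ⟨Empty, inferInstance, Empty.elim, by simp, ⟨
    { toFun := fun _ j => j.elim
      invFun := fun _ => 0
      map_add' := fun _ _ => Subsingleton.elim _ _
      map_smul' := fun _ _ => Subsingleton.elim _ _
      left_inv := fun _ => Subsingleton.elim _ _
      right_inv := fun _ => Subsingleton.elim _ _ }⟩⟩

theorem HasParts.prod (hM : HasParts I M s) (hN : HasParts I N t) :
    HasParts I (M × N) (s + t) := by
  obtain ⟨ι, _, n, hs, ⟨f⟩⟩ := hM
  obtain ⟨κ, _, m, ht, ⟨g⟩⟩ := hN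
  refine ⟨ι ⊕ κ, inferInstance, Sum.elim n m, ?_, ⟨(f.prodCongr g).trans
    (LinearEquiv.sumPiEquivProdPi R ι κ fun x => R ⧸ I ^ (Sum.elim n m x)).symm⟩⟩
  rw [← hs, ← ht, ← Finset.univ_disjSum_univ, Finset.val_disjSum, Multiset.disjSum,
    Multiset.map_add, Multiset.map_map, Multiset.map_map]
  rfl

theorem HasParts.pi {ι : Type} [Fintype ι] {M : ι → Type*} [∀ k, AddCommGroup (M k)]
    [∀ k, Module R (M k)] {s : ι → Multiset ℕ} (h : ∀ k, HasParts I (M k) (s k)) :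
    HasParts I (∀ k, M k) (∑ k, s k) := by
  choose κ hκ n hs e using h
  refine ⟨Σ k, κ k, inferInstance, fun x => n x.1 x.2, ?_,
    ⟨(LinearEquiv.piCongrRight fun k => (e k).some).trans
      (LinearEquiv.piCurry R fun k j => R ⧸ I ^ n k j).symm⟩⟩
  simp only [← hs, map_univ_val_eq_sum]
  exact Fintype.sum_sigma _

theorem HasParts.filter_ne_zero (h : HasParts I M s) : HasParts I M (s.filter (· ≠ 0)) := by
  classical
  obtain ⟨ι, _, n, hs, ⟨f⟩⟩ := h
  refine ⟨{j // n j ≠ 0}, inferInstance, fun j => n j, ?_, ⟨f.trans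
    { toFun := fun x j => x j
      invFun := fun y j => if hj : n j ≠ 0 then y ⟨j, hj⟩ else 0
      map_add' := fun _ _ => rfl
      map_smul' := fun _ _ => rfl
      left_inv := fun x => ?_
      right_inv := fun y => ?_ }⟩⟩
  · rw [← hs, Multiset.filter_map]
    have := congrArg (Multiset.map n) (congrArg Finset.val
      (Finset.subtype_map (s := (Finset.univ : Finset ι)) (fun j => n j ≠ 0)))
    simpa [Function.comp_def] using this
  · funext j
    by_cases hj : n j ≠ 0
    · simp [hj]
    · have : Subsingleton (R ⧸ I ^ n j) := by
        rw [not_not.mp hj, pow_zero, Ideal.one_eq_top]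
        exact Ideal.Quotient.subsingleton_iff.mpr rfl
      exact Subsingleton.elim _ _
  · funext ⟨j, hj⟩
    simp [hj]

/-- Truncation of a product of modules `R ⧸ I ^ n`. -/
theorem HasParts.quotient_smul_top {p : R} (hI : I = Ideal.span {p}) (h : HasParts I M s) (k : ℕ) :
    HasParts I (M ⧸ (I ^ k • (⊤ : Submodule R M))) (s.map (min k)) := by
  obtain ⟨ι, _, n, hs, ⟨f⟩⟩ := h
  let φ : (∀ j, R ⧸ I ^ n j) →ₗ[R] ∀ j, R ⧸ I ^ min k (n j) :=
    LinearMap.pi fun j => (Submodule.factor (Ideal.pow_le_pow_right (min_le_right k (n j)))).comp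
      (LinearMap.proj j)
  have hφ : Function.Surjective (φ.comp f.toLinearMap) := by
    have hs : Function.Surjective φ := by
      intro y
      choose x hx using fun j => Submodule.factor_surjective
        (Ideal.pow_le_pow_right (I := I) (min_le_right k (n j))) (y j)
      exact ⟨x, funext hx⟩
    exact hs.comp f.surjective
  have hker : LinearMap.ker (φ.comp f.toLinearMap) = I ^ k • (⊤ : Submodule R M) := by
    subst hI
    rw [Ideal.span_singleton_pow, Submodule.ideal_span_singleton_smul]
    ext x
    rw [LinearMap.mem_ker, Submodule.mem_smul_pointwise_iff_exists]
    constructor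
    · intro hx
      have : ∀ j, ∃ z : R ⧸ (Ideal.span {p}) ^ n j, p ^ k • z = f x j := by
        intro j
        obtain ⟨y, hy⟩ := Submodule.Quotient.mk_surjective _ (f x j)
        have h1 : φ (f x) j = 0 := congrFun hx j
        have h2 : φ (f x) j = Submodule.Quotient.mk y := by
          change Submodule.factor (Ideal.pow_le_pow_right (min_le_right k (n j))) (f x j) = _
          rw [← hy]
          rfl
        rw [h2, Submodule.Quotient.mk_eq_zero, Ideal.span_singleton_pow,
          Ideal.mem_span_singleton] at h1
        rcases le_total k (n j) with hk | hk
        · rw [min_eq_left hk] at h1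
          obtain ⟨c, rfl⟩ := h1
          exact ⟨Submodule.Quotient.mk c, by rw [← hy, ← Submodule.Quotient.mk_smul, smul_eq_mul]⟩
        · rw [min_eq_right hk] at h1
          refine ⟨0, ?_⟩
          rw [smul_zero, ← hy, eq_comm, Submodule.Quotient.mk_eq_zero, Ideal.span_singleton_pow,
            Ideal.mem_span_singleton]
          exact h1
      choose z hz using this
      refine ⟨f.symm z, trivial, f.injective ?_⟩
      rw [map_smul, f.apply_symm_apply]
      exact funext hz
    · rintro ⟨y, -, rfl⟩
      funext j
      obtain ⟨z, hz⟩ := Submodule.Quotient.mk_surjective _ (f y j)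
      change Submodule.factor (Ideal.pow_le_pow_right (min_le_right k (n j)))
        (f (p ^ k • y) j) = 0
      rw [map_smul, Pi.smul_apply, ← hz, ← Submodule.Quotient.mk_smul]
      change Submodule.Quotient.mk _ = _
      rw [Submodule.Quotient.mk_eq_zero, Ideal.span_singleton_pow, Ideal.mem_span_singleton]
      exact (pow_dvd_pow p (min_le_left k (n j))).mul_right z
  refine ⟨ι, inferInstance, fun j => min k (n j), ?_, ⟨(Submodule.quotEquivOfEq _ _ hker.symm).trans
    ((φ.comp f.toLinearMap).quotKerEquivOfSurjective hφ)⟩⟩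
  rw [← hs, Multiset.map_map]
  rfl

end HasParts

/-- A multiset of natural numbers is determined, up to zeros, by the sums of its truncations. -/
theorem filter_ne_zero_eq_of_sum_min {s t : Multiset ℕ}
    (h : ∀ k, (s.map (min k)).sum = (t.map (min k)).sum) :
    s.filter (· ≠ 0) = t.filter (· ≠ 0) := by
  -- Differences of consecutive truncated sums count the parts exceeding `k`; differences of these
  -- counts give the multiplicities of the positive parts.
  have step : ∀ (s : Multiset ℕ) k,
      (s.map (min (k + 1))).sum = (s.map (min k)).sum + s.countP (k < ·) := by
    intro s k
    induction s using Multiset.induction with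
    | empty => simp
    | cons a s ih =>
      rw [Multiset.map_cons, Multiset.sum_cons, ih, Multiset.map_cons, Multiset.sum_cons,
        Multiset.countP_cons]
      split_ifs <;> omega
  have hc : ∀ k, s.countP (k < ·) = t.countP (k < ·) := by
    intro k
    have h1 := h (k + 1)
    rw [step, step, h k] at h1
    omega
  have step2 : ∀ (s : Multiset ℕ) k,
      s.countP (k < ·) = s.countP (k + 1 < ·) + s.count (k + 1) := by
    intro s k
    induction s using Multiset.induction with
    | empty => simp
    | cons a s ih =>
      rw [Multiset.countP_cons, Multiset.countP_cons, Multiset.count_cons, ih]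
      split_ifs <;> omega
  ext a
  rcases a with _ | a
  · simp
  · have h1 := step2 s a
    have h2 := step2 t a
    rw [hc, hc] at h1
    simp only [Multiset.count_filter]
    split_ifs <;> omega

/-! ### Finite length modules over a discrete valuation ring -/

section DVR

variable {R : Type*} [CommRing R] [IsDomain R] [IsDiscreteValuationRing R]
  {M : Type*} [AddCommGroup M] [Module R M] {s t : Multiset ℕ}

theorem HasParts.length_eq (h : HasParts (maximalIdeal R) M s) :
    Module.length R M = (s.sum : ℕ∞) := by
  obtain ⟨ι, _, n, rfl, ⟨f⟩⟩ := h
  rw [f.length_eq, Module.length_pi_of_fintype]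
  simp only [IsDiscreteValuationRing.length_quotient_pow_maximalIdeal]
  rw [← Nat.cast_sum]
  rfl

/-- Uniqueness of the decomposition of a module of finite length. -/
theorem HasParts.unique (hs : HasParts (maximalIdeal R) M s) (ht : HasParts (maximalIdeal R) M t) :
    s.filter (· ≠ 0) = t.filter (· ≠ 0) := by
  obtain ⟨p, hp⟩ := IsDiscreteValuationRing.exists_irreducible R
  refine filter_ne_zero_eq_of_sum_min fun k => ?_
  have h1 := (hs.quotient_smul_top hp.maximalIdeal_eq k).length_eq
  rw [(ht.quotient_smul_top hp.maximalIdeal_eq k).length_eq] at h1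
  exact_mod_cast h1.symm

/-- The chain `p ^ n • x` stabilizes, so `p ^ n • x = p ^ (n + 1) • c • x` for some `n` and `c`; by
locality `1 - p * c` is a unit, and it kills `p ^ n • x`. -/
theorem exists_pow_smul_eq_zero {p : R} (hp : Irreducible p) [IsArtinian R M] (x : M) :
    ∃ n : ℕ, p ^ n • x = 0 := by
  obtain ⟨n, ⟨y, hy⟩, h⟩ := IsArtinian.exists_pow_succ_smul_dvd p
    (⟨x, Submodule.mem_span_singleton_self x⟩ : Submodule.span R {x})
  obtain ⟨c, rfl⟩ := Submodule.mem_span_singleton.mp hy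
  have h1 : p ^ n.succ • c • x = p ^ n • x := congrArg Subtype.val h
  have h2 : IsUnit (1 - p * c) := by
    refine (isUnit_or_isUnit_one_sub_self (p * c)).resolve_left fun h => ?_
    exact hp.not_isUnit (isUnit_of_mul_isUnit_left h)
  refine ⟨n, h2.smul_eq_zero.mp ?_⟩
  rw [sub_smul, one_smul, ← h1]
  simp only [smul_smul]
  rw [← sub_smul, Nat.succ_eq_add_one]
  have h3 : p ^ (n + 1) * c - p * c * (p ^ (n + 1) * c) = p * c * (p ^ n - p ^ (n + 1) * c) := by
    ring
  rw [h3, mul_smul, sub_smul, ← h1, smul_smul, sub_self, smul_zero]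

theorem exists_hasParts (h : IsFiniteLength R M) : ∃ s, HasParts (maximalIdeal R) M s := by
  classical
  obtain ⟨p, hp⟩ := IsDiscreteValuationRing.exists_irreducible R
  obtain ⟨_, _⟩ := isFiniteLength_iff_isNoetherian_isArtinian.mp h
  obtain ⟨d, k, ⟨e⟩⟩ := Module.torsion_by_prime_power_decomposition hp
    ((Submodule.isTorsion'_powers_iff (M := M) p).mpr fun x => exists_pow_smul_eq_zero hp x)
  refine ⟨_, Fin d, inferInstance, k, rfl, ⟨e.trans ((DirectSum.linearEquivFunOnFintype R (Fin d)
    (fun i => R ⧸ R ∙ p ^ k i)).trans (LinearEquiv.piCongrRight fun i =>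
      Submodule.quotEquivOfEq _ _ ?_))⟩⟩
  rw [hp.maximalIdeal_eq, Ideal.span_singleton_pow]

end DVR

end LRCyclic

namespace LRCyclic

open IsLocalRing

/-! ### Quotients by cyclic submodules -/

/-- Elimination of one relation: in `R ⧸ (p ^ n) × B` modulo the multiple `p ^ k` of `(1, b)`, where
`k ≤ n`, one can pass to the generators `(1, b)` and `B`. -/
theorem nonempty_quotient_span_equiv {R : Type*} [CommRing R] {B : Type*} [AddCommGroup B]
    [Module R B] {I : Ideal R} {p : R} (hI : I = Ideal.span {p}) {k n : ℕ} (hkn : k ≤ n) (b : B) :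
    Nonempty ((((R ⧸ I ^ n) × B) ⧸ Submodule.span R
        {((Submodule.Quotient.mk (p ^ k), p ^ k • b) : (R ⧸ I ^ n) × B)}) ≃ₗ[R]
      (R ⧸ I ^ k) × (B ⧸ Submodule.span R {p ^ n • b})) := by
  have hIn : ∀ m, I ^ m = Ideal.span {p ^ m} := fun m => by rw [hI, Ideal.span_singleton_pow]
  have hle : I ^ n ≤ I ^ k := Ideal.pow_le_pow_right hkn
  let ψ : (R ⧸ I ^ n) →ₗ[R] B ⧸ Submodule.span R {p ^ n • b} :=
    (I ^ n).liftQ ((Submodule.mkQ _).comp (LinearMap.toSpanSingleton R B b)) (by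
      intro x hx
      rw [hIn, Ideal.mem_span_singleton'] at hx
      obtain ⟨c, rfl⟩ := hx
      rw [LinearMap.mem_ker, LinearMap.comp_apply, LinearMap.toSpanSingleton_apply,
        Submodule.mkQ_apply, Submodule.Quotient.mk_eq_zero, mul_smul]
      exact Submodule.mem_span_singleton.mpr ⟨c, rfl⟩)
  -- This is `(x, y) ↦ (x, y - x • b)`, the change of generators to `g = (1, b)` and `B`. The
  -- relation `p ^ n • (1, 0) = 0` reads `p ^ n • g = p ^ n • b`; with `p ^ k • g = 0` and `k ≤ n`
  -- it becomes `p ^ n • b = 0`.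
  let φ : (R ⧸ I ^ n) × B →ₗ[R] (R ⧸ I ^ k) × (B ⧸ Submodule.span R {p ^ n • b}) :=
    ((Submodule.factor hle).comp (LinearMap.fst R _ _)).prod
      ((Submodule.mkQ _).comp (LinearMap.snd R _ _) - ψ.comp (LinearMap.fst R _ _))
  have hφ : ∀ (x : R) (y : B), φ (Submodule.Quotient.mk x, y) =
      (Submodule.Quotient.mk x, Submodule.Quotient.mk (y - x • b)) := fun x y => rfl
  have hsurj : Function.Surjective φ := by
    rintro ⟨x, y⟩
    obtain ⟨x, rfl⟩ := Submodule.Quotient.mk_surjective _ x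
    obtain ⟨y, rfl⟩ := Submodule.Quotient.mk_surjective _ y
    exact ⟨(Submodule.Quotient.mk x, y + x • b), by rw [hφ, add_sub_cancel_right]⟩
  have hker : LinearMap.ker φ = Submodule.span R
      {((Submodule.Quotient.mk (p ^ k), p ^ k • b) : (R ⧸ I ^ n) × B)} := by
    apply le_antisymm
    · rintro ⟨x, y⟩ h
      obtain ⟨x, rfl⟩ := Submodule.Quotient.mk_surjective _ x
      rw [LinearMap.mem_ker, hφ, Prod.mk_eq_zero, Submodule.Quotient.mk_eq_zero,
        Submodule.Quotient.mk_eq_zero, hIn, Ideal.mem_span_singleton',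
        Submodule.mem_span_singleton] at h
      obtain ⟨⟨z, hz⟩, w, hw⟩ := h
      have hpn : p ^ n = p ^ (n - k) * p ^ k := by rw [← pow_add, Nat.sub_add_cancel hkn]
      refine Submodule.mem_span_singleton.mpr ⟨z + w * p ^ (n - k), Prod.ext ?_ ?_⟩
      · change Submodule.Quotient.mk ((z + w * p ^ (n - k)) * p ^ k) = Submodule.Quotient.mk x
        rw [Submodule.Quotient.eq, ← hz, add_mul, add_sub_cancel_left, mul_assoc, ← hpn, hIn]
        exact Ideal.mem_span_singleton'.mpr ⟨w, rfl⟩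
      · change (z + w * p ^ (n - k)) • p ^ k • b = y
        rw [smul_smul, add_mul, mul_assoc, ← hpn, hz, add_smul, mul_smul, hw, add_sub_cancel]
    · rw [Submodule.span_singleton_le_iff_mem, LinearMap.mem_ker, hφ, sub_self]
      refine Prod.ext ?_ rfl
      rw [Prod.fst_zero, Submodule.Quotient.mk_eq_zero, hIn]
      exact Ideal.mem_span_singleton_self _
  exact ⟨(Submodule.quotEquivOfEq _ _ hker.symm).trans (φ.quotKerEquivOfSurjective hsurj)⟩

/-- Height at time `i` of the column `C(e,f)_n`. -/
def columnHeight (c : ℕ × ℕ × ℕ) (i : ℕ) : ℕ := c.2.2 - (c.2.1 - max i (c.1 - 1))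

/-- The triple `(e, f, n)` describes a column. -/
def IsColumnIndex (c : ℕ × ℕ × ℕ) : Prop :=
  (1 ≤ c.1 ∧ c.1 ≤ c.2.1 ∧ c.2.1 + 1 ≤ c.2.2 + c.1) ∨ (c.1 = 1 ∧ c.2.1 = 0)

section

variable {R : Type*} [CommRing R] {I : Ideal R} {p : R} {B : Type*} [AddCommGroup B] [Module R B]

/-- The quotient of a product by a product of submodules. -/
noncomputable def quotientProdEquiv {M N : Type*} [AddCommGroup M] [Module R M] [AddCommGroup N]
    [Module R N] (P : Submodule R M) (Q : Submodule R N) :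
    ((M × N) ⧸ P.prod Q) ≃ₗ[R] (M ⧸ P) × (N ⧸ Q) :=
  (Submodule.quotEquivOfEq _ _ (by rw [LinearMap.ker_prodMap, Submodule.ker_mkQ,
    Submodule.ker_mkQ])).trans ((P.mkQ.prodMap Q.mkQ).quotKerEquivOfSurjective
      (P.mkQ_surjective.prodMap Q.mkQ_surjective))

/-- Adding a column of height `h + f` with last entry `f` in front of the embedding generated
by `p ^ h • b`. -/
theorem HasParts.cons (hI : I = Ideal.span {p}) {h f i : ℕ} {b : B} {s : Multiset ℕ}
    (hB : HasParts I (B ⧸ Submodule.span R {p ^ (max i f + h) • b}) s) :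
    HasParts I (((R ⧸ I ^ (h + f)) × B) ⧸ Submodule.span R
      {p ^ i • ((Submodule.Quotient.mk (p ^ h), p ^ h • b) : (R ⧸ I ^ (h + f)) × B)})
      ({h + min i f} + s) := by
  have hgen : p ^ i • ((Submodule.Quotient.mk (p ^ h), p ^ h • b) : (R ⧸ I ^ (h + f)) × B) =
      (Submodule.Quotient.mk (p ^ (i + h)), p ^ (i + h) • b) := by
    rw [Prod.smul_mk, ← Submodule.Quotient.mk_smul, smul_eq_mul, ← pow_add, smul_smul, ← pow_add]
  rw [hgen]
  -- For `i ≤ f` the relation is eliminated with exponents `i + h ≤ h + f`. For `i ≥ f` its first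
  -- coordinate vanishes, so the front factor survives whole.
  rcases le_total i f with hif | hif
  · obtain ⟨e⟩ := nonempty_quotient_span_equiv hI (show i + h ≤ h + f by omega) b
    rw [min_eq_left hif, add_comm h i]
    refine HasParts.congr ((hasParts_quotient_pow I (i + h)).prod ?_) e.symm
    rw [max_eq_right hif] at hB
    rwa [add_comm h f]
  · rw [min_eq_right hif]
    rw [max_eq_left hif] at hB
    have h0 : (Submodule.Quotient.mk (p ^ (i + h)) : R ⧸ I ^ (h + f)) = 0 := by
      rw [Submodule.Quotient.mk_eq_zero, hI, Ideal.span_singleton_pow, Ideal.mem_span_singleton]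
      exact pow_dvd_pow p (by omega)
    have h1 : Submodule.span R {(((0 : R ⧸ I ^ (h + f)), p ^ (i + h) • b) : (R ⧸ I ^ (h + f)) × B)}
        = Submodule.prod ⊥ (Submodule.span R {p ^ (i + h) • b}) := by
      ext ⟨x, y⟩
      simp only [Submodule.mem_span_singleton, Submodule.mem_prod, Submodule.mem_bot, Prod.smul_mk,
        smul_zero, Prod.mk.injEq, exists_and_left]
      exact ⟨fun ⟨h, h'⟩ => ⟨h.symm, h'⟩, fun ⟨h, h'⟩ => ⟨h.symm, h'⟩⟩
    rw [h0, h1]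
    exact HasParts.congr ((hasParts_quotient_pow I (h + f)).prod hB)
      (((Submodule.quotEquivOfEqBot _ rfl).symm.prodCongr (LinearEquiv.refl R _)).trans
        (quotientProdEquiv _ _).symm)

theorem HasParts.quotient_span_congr {C : Type*} [AddCommGroup C] [Module R C] {a : B} {c : C}
    {s : Multiset ℕ} {r : R} (φ : B ≃ₗ[R] C) (u : Rˣ) (h : φ a = (u : R) • c)
    (hC : HasParts I (C ⧸ Submodule.span R {r • c}) s) :
    HasParts I (B ⧸ Submodule.span R {r • a}) s := by
  refine hC.congr (Submodule.Quotient.equiv _ _ φ ?_).symm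
  rw [Submodule.map_span, Set.image_singleton]
  change Submodule.span R {φ (r • a)} = _
  rw [map_smul, h, smul_comm]
  exact Submodule.span_singleton_smul_eq u.isUnit _

end

/-! ### From cyclic embeddings to columns -/

section DVR

variable {R : Type u} [CommRing R] [IsDomain R] [IsDiscreteValuationRing R]

theorem exists_unit_smul_pow {p : R} (hp : Irreducible p) {n : ℕ} (x : R ⧸ maximalIdeal R ^ n) :
    ∃ (u : Rˣ) (h : ℕ), h ≤ n ∧ x = (u : R) • Submodule.Quotient.mk (p ^ h) := by
  obtain ⟨y, rfl⟩ := Submodule.Quotient.mk_surjective _ x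
  by_cases hy : y ∈ maximalIdeal R ^ n
  -- Zero is represented by `p ^ n`, so that `h ≤ n` holds without exception.
  · refine ⟨1, n, le_rfl, ?_⟩
    rw [(Submodule.Quotient.mk_eq_zero _).mpr hy, eq_comm, Units.val_one, one_smul,
      Submodule.Quotient.mk_eq_zero]
    exact Ideal.pow_mem_pow ((mem_maximalIdeal p).mpr hp.not_isUnit) n
  · have hy0 : y ≠ 0 := fun h => hy (h ▸ zero_mem _)
    obtain ⟨h, u, rfl⟩ := IsDiscreteValuationRing.eq_unit_mul_pow_irreducible hy0 hp
    refine ⟨u, h, ?_, rfl⟩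
    by_contra! hlt
    exact hy (Ideal.mul_mem_left _ _ (Ideal.pow_le_pow_right hlt.le
      (Ideal.pow_mem_pow ((mem_maximalIdeal p).mpr hp.not_isUnit) h)))

/-- The tableau of a cyclic embedding is a union of columns. -/
theorem exists_columns_of_cyclic {p : R} (hp : Irreducible p) (d : ℕ) :
    ∀ {B : Type u} [AddCommGroup B] [Module R B] {s : Multiset ℕ} (_ : HasParts (maximalIdeal R) B s)
      (_ : s.card = d) (a : B) (i₀ : ℕ), ∃ S : Multiset (ℕ × ℕ × ℕ), (∀ c ∈ S, IsColumnIndex c) ∧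
      ∀ i, HasParts (maximalIdeal R) (B ⧸ Submodule.span R {p ^ max i i₀ • a})
        (S.map fun c => columnHeight c i) := by
  classical
  induction d with
  | zero =>
    intro B _ _ s hB hs a i₀
    obtain ⟨ι, _, n, rfl, ⟨e⟩⟩ := hB
    have : IsEmpty ι := Fintype.card_eq_zero_iff.mp (by simpa using hs)
    have : Subsingleton B := e.toEquiv.subsingleton
    exact ⟨0, by simp, fun i => hasParts_zero⟩
  | succ d ih =>
    intro B _ _ s hB hs a i₀
    obtain ⟨ι, _, n, rfl, ⟨e⟩⟩ := hB
    choose u h hn hu using fun j => exists_unit_smul_pow hp (e a j)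
    have : Nonempty ι := Fintype.card_pos_iff.mp (by simp at hs; omega)
    -- Minimality of `h t` makes `p ^ h t` divide every coordinate of `a`, which defines `b` below.
    obtain ⟨t, ht⟩ := Finite.exists_min h
    obtain ⟨f, hf⟩ := Nat.exists_eq_add_of_le (hn t)
    let b : ∀ j : {j // j ≠ t}, R ⧸ maximalIdeal R ^ n j := fun j =>
      (((u t)⁻¹ * u j : Rˣ) : R) • Submodule.Quotient.mk (p ^ (h j - h t))
    have hb : HasParts (maximalIdeal R) (∀ j : {j // j ≠ t}, R ⧸ maximalIdeal R ^ n j)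
      (Finset.univ.val.map fun j : {j // j ≠ t} => n j) :=
      ⟨{j // j ≠ t}, inferInstance, fun j => n j, rfl, ⟨LinearEquiv.refl _ _⟩⟩
    have hcard : (Finset.univ.val.map fun j : {j // j ≠ t} => n j).card = d := by
      have h1 : Fintype.card ι = d + 1 := by simpa using hs
      have h2 : Fintype.card {j // j ≠ t} = d := by
        rw [Fintype.card_subtype_compl, h1, Fintype.card_subtype_eq, Nat.add_sub_cancel]
      rw [Multiset.card_map]
      exact h2
    obtain ⟨S, hS, hS'⟩ := ih hb hcard (p ^ h t • b) (max i₀ f)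
    -- Only times `≥ i₀` are seen, so the entries `1, …, i₀` are missing from the column; if `f ≤
    -- i₀`, its height never changes and it is an empty column.
    refine ⟨(if f ≤ i₀ then (1, 0, h t + f) else (i₀ + 1, f, h t + f)) ::ₘ S, ?_, fun i => ?_⟩
    · rw [Multiset.forall_mem_cons]
      refine ⟨?_, hS⟩
      split_ifs with hfi
      · exact Or.inr ⟨rfl, rfl⟩
      · refine Or.inl ⟨?_, ?_, ?_⟩ <;> simp only <;> omega
    · have hcol : columnHeight (if f ≤ i₀ then (1, 0, h t + f) else (i₀ + 1, f, h t + f)) i =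
          h t + min (max i i₀) f := by
        split_ifs <;> simp only [columnHeight] <;> omega
      rw [Multiset.map_cons, hcol, ← Multiset.singleton_add]
      have key := HasParts.cons hp.maximalIdeal_eq (h := h t) (f := f) (i := max i i₀) (b := b)
        (by rw [pow_add, mul_smul, max_assoc]; exact hS' i)
      rw [← hf] at key
      refine HasParts.quotient_span_congr (e.trans (piSplitAtLinear R t _)) (u t) ?_ key
      refine Prod.ext (hu t) (funext fun j => ?_)
      change e a j = (u t : R) • p ^ h t • (((u t)⁻¹ * u j : Rˣ) : R) •
        Submodule.Quotient.mk (p ^ (h j - h t))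
      simp only [hu j, ← Submodule.Quotient.mk_smul, smul_eq_mul, Units.val_mul]
      congr 1
      have h1 : p ^ h j = p ^ h t * p ^ (h j - h t) := by
        rw [← pow_add, Nat.add_sub_cancel' (ht j)]
      have h2 : (u t : R) * ((u t)⁻¹ : Rˣ) = 1 := Units.mul_inv _
      rw [h1]
      linear_combination (-(u j : R) * p ^ h t * p ^ (h j - h t)) * h2

end DVR
end LRCyclic

namespace LRCyclic

open IsLocalRing

/-! ### Partitions and types of modules -/

theorem parts_eq_map_univ (μ : YoungDiagram) :
    parts μ = Finset.univ.val.map fun j : Fin (μ.rowLen 0) => μ.colLen j := by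
  rw [map_univ_val_eq_sum, ← Finset.sum_range fun j => ({μ.colLen j} : Multiset ℕ), parts,
    Finset.sum_eq_multiset_sum, ← Multiset.sum_map_singleton (Multiset.map _ _), Multiset.map_map]
  rfl

theorem filter_ne_zero_parts (μ : YoungDiagram) : (parts μ).filter (· ≠ 0) = parts μ := by
  refine Multiset.filter_eq_self.mpr fun a ha => ?_
  obtain ⟨j, hj, rfl⟩ := Multiset.mem_map.mp ha
  rw [Multiset.mem_range, ← YoungDiagram.mem_iff_lt_rowLen, YoungDiagram.mem_iff_lt_colLen] at hj
  omega

theorem parts_columnDiagram (n : ℕ) :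
    parts (columnDiagram n) = ({n} : Multiset ℕ).filter (· ≠ 0) := by
  have hmem : ∀ i j, (i, j) ∈ columnDiagram n ↔ i < n ∧ j = 0 := by
    intro i j
    rw [← YoungDiagram.mem_cells]
    simp [columnDiagram, eq_comm]
  have hrow : ∀ j, j < (columnDiagram n).rowLen 0 ↔ 0 < n ∧ j = 0 := fun j => by
    rw [← YoungDiagram.mem_iff_lt_rowLen, hmem]
  have hcol : ∀ i, i < (columnDiagram n).colLen 0 ↔ i < n := fun i => by
    rw [← YoungDiagram.mem_iff_lt_colLen, hmem]
    simp
  have hcol' : (columnDiagram n).colLen 0 = n := by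
    have h1 := hcol n
    have h2 := hcol ((columnDiagram n).colLen 0)
    omega
  rcases Nat.eq_zero_or_pos n with hn | hn
  · have h0 : (columnDiagram n).rowLen 0 = 0 := by
      have := hrow 0
      omega
    rw [parts, h0, hn]
    rfl
  · have h1 : (columnDiagram n).rowLen 0 = 1 := by
      have h0 := hrow 0
      have h1 := hrow 1
      omega
    rw [parts, h1, Multiset.filter_singleton, if_pos hn.ne']
    change Multiset.map _ {0} = _
    rw [Multiset.map_singleton, hcol']

theorem column_diagram (e f n i : ℕ) :
    (column e f n).diagram i = columnDiagram (columnHeight (e, f, n) i) := rfl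

theorem filter_ne_zero_sum {α : Type*} (A : Finset α) (s : α → Multiset ℕ) :
    (∑ k ∈ A, s k).filter (· ≠ 0) = ∑ k ∈ A, (s k).filter (· ≠ 0) := by
  classical
  induction A using Finset.induction_on with
  | empty => simp
  | insert a A ha ih => rw [Finset.sum_insert ha, Finset.sum_insert ha, Multiset.filter_add, ih]

/-- Passes from tableaux to index triples. The filter is needed because a column may have height `0`
at early times, while `parts` lists nonzero lengths only. -/
theorem isUnionOfColumns_iff (Γ : Tableau) : Γ.IsUnionOfColumns ↔
    ∃ (N : ℕ) (c : Fin N → ℕ × ℕ × ℕ), (∀ k, IsColumnIndex (c k)) ∧ ∀ i, parts (Γ.diagram i) =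
      (Finset.univ.val.map fun k => columnHeight (c k) i).filter (· ≠ 0) := by
  constructor
  · rintro ⟨N, C, hC, hΓ⟩
    choose e f n h hC using hC
    refine ⟨N, fun k => (e k, f k, n k), h, fun i => ?_⟩
    rw [hΓ i, map_univ_val_eq_sum, filter_ne_zero_sum]
    refine Finset.sum_congr rfl fun k _ => ?_
    rw [hC k, column_diagram, parts_columnDiagram]
  · rintro ⟨N, c, hc, hΓ⟩
    refine ⟨N, fun k => column (c k).1 (c k).2.1 (c k).2.2,
      fun k => ⟨_, _, _, hc k, rfl⟩, fun i => ?_⟩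
    rw [hΓ i, map_univ_val_eq_sum, filter_ne_zero_sum]
    refine Finset.sum_congr rfl fun k _ => ?_
    rw [column_diagram, parts_columnDiagram]

theorem hasType_iff {R : Type u} [CommRing R] [IsLocalRing R] {M : Type u} [AddCommGroup M]
    [Module R M] (μ : YoungDiagram) : HasType R M μ ↔
      ∃ s, HasParts (maximalIdeal R) M s ∧ s.filter (· ≠ 0) = parts μ := by
  constructor
  · intro h
    exact ⟨parts μ, ⟨_, inferInstance, _, (parts_eq_map_univ μ).symm, h⟩, filter_ne_zero_parts μ⟩
  · rintro ⟨s, hs, hμ⟩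
    obtain ⟨ι, _, n, hn, ⟨f⟩⟩ := hs.filter_ne_zero
    rw [hμ, parts_eq_map_univ] at hn
    obtain ⟨e, he⟩ := exists_equiv_of_map_univ_eq hn
    exact ⟨(f.trans (LinearEquiv.piCongrRight fun a => Submodule.quotEquivOfEq _
      (maximalIdeal R ^ μ.colLen (e a)) (by rw [he a]))).trans
        (LinearEquiv.piCongrLeft R (fun j : Fin (μ.rowLen 0) => R ⧸ maximalIdeal R ^ μ.colLen j) e)⟩

/-! ### Quotients of direct sums of embeddings -/

/-- Multiples of a single `r` can be chosen independently in each coordinate, hence the restriction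
to principal ideals. -/
theorem span_singleton_smul_pi {R : Type*} [CommRing R] (r : R) {ι : Type*} {M : ι → Type*}
    [∀ k, AddCommGroup (M k)] [∀ k, Module R (M k)] (A : ∀ k, Submodule R (M k)) :
    Ideal.span {r} • Submodule.pi Set.univ A =
      Submodule.pi Set.univ fun k => Ideal.span {r} • A k := by
  simp only [Submodule.ideal_span_singleton_smul]
  ext x
  simp only [Submodule.mem_smul_pointwise_iff_exists, Submodule.mem_pi, Set.mem_univ,
    true_implies]
  constructor
  · rintro ⟨y, hy, rfl⟩ k
    exact ⟨y k, hy k, rfl⟩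
  · intro h
    choose y hy hx using h
    exact ⟨y, hy, funext hx⟩

theorem span_singleton_smul_span_singleton {R : Type*} [CommRing R] (r : R) {M : Type*}
    [AddCommGroup M] [Module R M] (a : M) :
    Ideal.span {r} • Submodule.span R {a} = Submodule.span R {r • a} := by
  rw [Submodule.ideal_span_singleton_smul, Submodule.smul_span, Set.smul_set_singleton]

variable {R : Type u} [CommRing R] [IsDomain R] [IsDiscreteValuationRing R]

theorem Embedding.hasParts_directSum {n : ℕ} (F : Fin n → Embedding R) (i : ℕ)
    {s : Fin n → Multiset ℕ} (h : ∀ k, HasParts (maximalIdeal R)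
      ((F k).ambient ⧸ (maximalIdeal R ^ i • (F k).sub)) (s k)) :
    HasParts (maximalIdeal R) ((Embedding.directSum F).ambient ⧸
      (maximalIdeal R ^ i • (Embedding.directSum F).sub)) (∑ k, s k) := by
  obtain ⟨p, hp⟩ := IsDiscreteValuationRing.exists_irreducible R
  have hpi : maximalIdeal R ^ i • (Embedding.directSum F).sub =
      Submodule.pi Set.univ fun k => maximalIdeal R ^ i • (F k).sub := by
    rw [hp.maximalIdeal_eq, Ideal.span_singleton_pow]
    exact span_singleton_smul_pi _ _
  exact (HasParts.pi h).congr ((Submodule.quotientPi _).symm.trans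
    (Submodule.quotEquivOfEq _ _ hpi.symm))

/-- The tableau of a direct sum of cyclic embeddings is a union of columns. -/
theorem Embedding.isUnionOfColumns_of_isDirectSumOfCyclics {E : Embedding R} {Γ : Tableau}
    (hE : E.IsDirectSumOfCyclics) (hΓ : E.HasTableau Γ) : Γ.IsUnionOfColumns := by
  obtain ⟨p, hp⟩ := IsDiscreteValuationRing.exists_irreducible R
  obtain ⟨n, F, hF, φ, hφ⟩ := hE
  have key : ∀ k, ∃ S : Multiset (ℕ × ℕ × ℕ), (∀ c ∈ S, IsColumnIndex c) ∧
      ∀ i, HasParts (maximalIdeal R) ((F k).ambient ⧸ (maximalIdeal R ^ i • (F k).sub))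
        (S.map fun c => columnHeight c i) := by
    intro k
    obtain ⟨a, ha⟩ := hF k
    obtain ⟨s, hs⟩ := exists_hasParts (F k).finiteLength
    obtain ⟨S, hS, h⟩ := exists_columns_of_cyclic hp s.card hs rfl a 0
    refine ⟨S, hS, fun i => (h i).congr (Submodule.quotEquivOfEq _ _ ?_)⟩
    rw [ha, hp.maximalIdeal_eq, Ideal.span_singleton_pow, span_singleton_smul_span_singleton,
      max_eq_left (Nat.zero_le i)]
  choose S hS h using key
  obtain ⟨l, hl⟩ : ∃ l : List (ℕ × ℕ × ℕ), (l : Multiset (ℕ × ℕ × ℕ)) = ∑ k, S k :=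
    Quot.exists_rep _
  have hmap : ∀ i, (Finset.univ.val.map fun k => columnHeight (l.get k) i) =
      ∑ k, (S k).map fun c => columnHeight c i := by
    intro i
    have h1 : Finset.univ.val.map l.get = ∑ k, S k := by
      rw [Fin.univ_val_map, List.ofFn_get, hl]
    have h2 := map_sum (Multiset.mapAddMonoidHom fun c => columnHeight c i) S Finset.univ
    rw [← h1, Multiset.coe_mapAddMonoidHom, Multiset.map_map] at h2
    exact h2
  rw [isUnionOfColumns_iff]
  refine ⟨l.length, l.get, fun k => ?_, fun i => ?_⟩
  · have h1 : l.get k ∈ (l : Multiset (ℕ × ℕ × ℕ)) := l.get_mem k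
    rw [hl, Multiset.mem_sum] at h1
    obtain ⟨j, -, hj⟩ := h1
    exact hS j _ hj
  · obtain ⟨s, hs, hs'⟩ := (hasType_iff _).mp (hΓ i)
    rw [hmap, ← hs']
    refine HasParts.unique hs ((Embedding.hasParts_directSum F i fun k => h k i).congr
      (Submodule.Quotient.equiv _ _ φ ?_).symm)
    rw [← hφ]
    exact Submodule.map_smul'' _ _ _

end LRCyclic

namespace LRCyclic

open IsLocalRing

/-! ### Cyclic embeddings from chains of columns -/

/-- The heights at time `i` of the columns in the chain which starts at `k` (of at most `N`
columns). -/
def chainHeights {ι : Type*} (c : ι → ℕ × ℕ × ℕ) (succ : ι → Option ι) :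
    ℕ → ι → ℕ → Multiset ℕ
  | 0, _, _ => 0
  | N + 1, k, i => {columnHeight (c k) i} +
      (succ k).elim 0 fun k' => chainHeights c succ N k' i

/-- `k'` can follow `k` in a chain: the entries of the column `c k'` continue those of `c k`, in
rows which lie strictly below. -/
structure Follows {ι : Type*} (c : ι → ℕ × ℕ × ℕ) (k k' : ι) : Prop where
  entry : (c k').1 = (c k).2.1 + 1
  row : (c k).2.2 + (c k').2.1 ≤ (c k').2.2 + (c k).2.1

section

variable {ι : Type*} {c : ι → ℕ × ℕ × ℕ} {succ : ι → Option ι}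

/-- The bound `2 ≤ (c k').1` excludes the case that `c k` is empty: its successor would start with
`1`, and a chain of empty columns need not end. -/
theorem Follows.lt (hc : ∀ k, IsColumnIndex (c k)) {k k' : ι} (h : Follows c k k')
    (h2 : 2 ≤ (c k').1) : (c k).1 < (c k').1 := by
  have := h.entry
  rcases hc k with h' | h' <;> omega

/-- First entries increase strictly along a chain and are bounded by `F`, so the chain ends before
the fuel `N` is used up. -/
theorem chainHeights_stable (hc : ∀ k, IsColumnIndex (c k))
    (hs : ∀ k k', succ k = some k' → Follows c k k' ∧ 2 ≤ (c k').1) {F : ℕ}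
    (hF : ∀ k, (c k).1 ≤ F) (N : ℕ) : ∀ k i, F < (c k).1 + N →
      chainHeights c succ (N + 1) k i = chainHeights c succ N k i := by
  induction N with
  | zero =>
    intro k i h
    have := hF k
    omega
  | succ N ih =>
    intro k i h
    rw [chainHeights, chainHeights]
    congr 1
    rcases hk : succ k with _ | k'
    · rfl
    · obtain ⟨h1, h2⟩ := hs k k' hk
      have := h1.lt hc h2
      exact ih k' i (by omega)

/-- The embedding belonging to a chain of columns. -/
theorem exists_cyclic_of_chain {R : Type u} [CommRing R] [IsDomain R] [IsDiscreteValuationRing R]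
    {p : R} (hp : Irreducible p) (hc : ∀ k, IsColumnIndex (c k))
    (hs : ∀ k k', succ k = some k' → Follows c k k' ∧ 2 ≤ (c k').1)
    (hn : ∀ k, (c k).2.1 ≤ (c k).2.2) {F : ℕ}
    (hF : ∀ k, (c k).1 ≤ F) (N : ℕ) : ∀ k, F < (c k).1 + N →
      ∃ (B : Type u) (_ : AddCommGroup B) (_ : Module R B) (b : B), IsFiniteLength R B ∧
      ∀ i, HasParts (maximalIdeal R)
        (B ⧸ Submodule.span R {p ^ (max i ((c k).1 - 1)) • p ^ ((c k).2.2 - (c k).2.1) • b})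
        (chainHeights c succ N k i) := by
  induction N with
  | zero =>
    intro k h
    have := hF k
    omega
  | succ N ih =>
    intro k h
    obtain ⟨h₀, hh₀⟩ := Nat.exists_eq_add_of_le' (hn k)
    have hlen' : ∀ m (B : Type u) [AddCommGroup B] [Module R B], IsFiniteLength R B →
        IsFiniteLength R ((R ⧸ maximalIdeal R ^ m) × B) := fun m B _ _ hB => by
      rw [← Module.length_ne_top_iff] at hB ⊢
      rw [Module.length_prod, IsDiscreteValuationRing.length_quotient_pow_maximalIdeal]
      exact WithTop.add_ne_top.mpr ⟨ENat.natCast_ne_top m, hB⟩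
    -- The new column contributes the factor `R ⧸ (p ^ n)` with generator `(1, b)`, and
    -- `HasParts.cons` splits it off; only the tail, with a suitable `b`, has to be supplied.
    suffices hsuff : ∃ (B : Type u) (_ : AddCommGroup B) (_ : Module R B) (b : B),
        IsFiniteLength R B ∧ ∀ i, HasParts (maximalIdeal R)
          (B ⧸ Submodule.span R {p ^ (max (max i ((c k).1 - 1)) (c k).2.1 + h₀) • b})
          ((succ k).elim 0 fun k' => chainHeights c succ N k' i) by
      obtain ⟨B, _, _, b, hB, h⟩ := hsuff
      refine ⟨(R ⧸ maximalIdeal R ^ (h₀ + (c k).2.1)) × B, inferInstance, inferInstance,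
        (Submodule.Quotient.mk 1, b), hlen' _ B hB, fun i => ?_⟩
      have h1 : p ^ ((c k).2.2 - (c k).2.1) • ((Submodule.Quotient.mk 1, b) :
          (R ⧸ maximalIdeal R ^ (h₀ + (c k).2.1)) × B) =
          (Submodule.Quotient.mk (p ^ h₀), p ^ h₀ • b) := by
        rw [hh₀, Nat.add_sub_cancel, Prod.smul_mk, ← Submodule.Quotient.mk_smul, smul_eq_mul,
          mul_one]
      have h2 : columnHeight (c k) i = h₀ + min (max i ((c k).1 - 1)) (c k).2.1 := by
        rw [columnHeight, hh₀]
        omega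
      rw [h1, chainHeights, h2]
      exact HasParts.cons hp.maximalIdeal_eq (h i)
    rcases hk : succ k with _ | k'
    · exact ⟨PUnit, inferInstance, inferInstance, 0, IsFiniteLength.of_subsingleton,
        fun i => hasParts_zero⟩
    · obtain ⟨h1, h2⟩ := hs k k' hk
      have h3 := h1.lt hc h2
      obtain ⟨B, _, _, b, hB, h⟩ := ih k' (by omega)
      have hrow := h1.row
      have hentry := h1.entry
      have hn' := hn k'
      -- The row condition gives `n - f ≤ n' - f'`, so this subtraction is not truncated. Since `e'
      -- - 1 = f ≥ e - 1`, both clocks agree.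
      refine ⟨B, _, _, p ^ ((c k').2.2 - (c k').2.1 - h₀) • b, hB, fun i => ?_⟩
      have h4 : p ^ (max (max i ((c k).1 - 1)) (c k).2.1 + h₀) •
          p ^ ((c k').2.2 - (c k').2.1 - h₀) • b =
          p ^ (max i ((c k').1 - 1)) • p ^ ((c k').2.2 - (c k').2.1) • b := by
        rw [smul_smul, smul_smul, ← pow_add, ← pow_add]
        congr 2
        omega
      rw [h4]
      exact h i

end

/-- The sum of a function over the starting points of the chains. -/
theorem sum_starts_eq {ι A : Type*} [Fintype ι] [AddCancelCommMonoid A] (P : ι → Prop)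
    [DecidablePred P] {succ : ι → Option ι} {pred : {k // P k} → ι}
    (hpred : ∀ k, succ (pred k) = some k.1) (hnone : ∀ k, k ∉ Set.range pred → succ k = none)
    {g a : ι → A} (hg : ∀ k, g k = a k + (succ k).elim 0 g) :
    ∑ k : {k // ¬ P k}, g k = ∑ k, a k := by
  have hinj : Function.Injective pred := fun x y h => by
    have := hpred x
    rw [h, hpred y] at this
    exact Subtype.ext (Option.some.inj this).symm
  -- The columns with a predecessor are exactly the successors, each occurring once, so they
  -- contribute the sum of `g` over all successors and cancel.
  have h1 : ∑ k : {k // P k}, g k = ∑ k, (succ k).elim 0 g :=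
    Fintype.sum_of_injective pred hinj _ _ (fun k hk => by rw [hnone k hk]; rfl)
      (fun k => by rw [hpred k]; rfl)
  have h2 : ∑ k, g k = ∑ k, a k + ∑ k, (succ k).elim 0 g := by
    rw [← Finset.sum_add_distrib]
    exact Finset.sum_congr rfl fun k _ => hg k
  rw [← Fintype.sum_subtype_add_sum_subtype P g, h1, add_comm] at h2
  exact add_right_cancel h2

/-- A direct sum of cyclic embeddings whose tableau is a given union of columns, when the columns
can be arranged in chains. -/
theorem exists_embedding_of_pred (R : Type u) [CommRing R] [IsDomain R]
    [IsDiscreteValuationRing R] {ι : Type} [Fintype ι] {c : ι → ℕ × ℕ × ℕ}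
    (hc : ∀ k, IsColumnIndex (c k)) (pred : {k // 2 ≤ (c k).1} → ι)
    (hinj : Function.Injective pred) (hpred : ∀ k, Follows c (pred k) k) :
    ∃ E : Embedding R, E.IsDirectSumOfCyclics ∧ ∀ i, HasParts (maximalIdeal R)
      (E.ambient ⧸ (maximalIdeal R ^ i • E.sub))
      (Finset.univ.val.map fun k => columnHeight (c k) i) := by
  classical
  obtain ⟨p, hp⟩ := IsDiscreteValuationRing.exists_irreducible R
  -- A column on its own may have `f > n`, when its first entry is large. But `n - f` does not
  -- decrease along a chain, and it is nonnegative for the columns starting with `1`.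
  have hn : ∀ e k, (c k).1 = e → (c k).2.1 ≤ (c k).2.2 := by
    intro e
    induction e using Nat.strong_induction_on with
    | _ e ih =>
      intro k hk
      by_cases h2 : 2 ≤ (c k).1
      · have h := hpred ⟨k, h2⟩
        have h' := h.lt hc h2
        have h1 := ih _ (hk ▸ h') _ rfl
        have := h.row
        simp only at this
        omega
      · rcases hc k with h | h <;> omega
  let succ : ι → Option ι := fun k => if h : ∃ x, pred x = k then some h.choose.1 else none
  have hsucc : ∀ k, succ (pred k) = some k.1 := fun k => by
    have h : ∃ x, pred x = pred k := ⟨k, rfl⟩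
    simp only [succ, dif_pos h]
    rw [hinj h.choose_spec]
  have hnone : ∀ k, k ∉ Set.range pred → succ k = none := fun k hk => dif_neg hk
  have hs : ∀ k k', succ k = some k' → Follows c k k' ∧ 2 ≤ (c k').1 := by
    intro k k' h
    by_cases hk : k ∈ Set.range pred
    · obtain ⟨x, rfl⟩ := hk
      rw [hsucc] at h
      obtain rfl := Option.some.inj h
      exact ⟨hpred x, x.2⟩
    · rw [hnone k hk] at h
      cases h
  let F := Finset.univ.sup fun k => (c k).1
  have hF : ∀ k, (c k).1 ≤ F := fun k => Finset.le_sup (f := fun k => (c k).1) (Finset.mem_univ k)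
  have hpos : ∀ k, 1 ≤ (c k).1 := fun k => by rcases hc k with h | h <;> omega
  have hfuel : ∀ k, F < (c k).1 + F := fun k => by
    have := hpos k
    omega
  choose B i₁ i₂ b hB h using fun k => exists_cyclic_of_chain hp hc hs (fun k => hn _ k rfl) hF F k
    (hfuel k)
  let e := Fintype.equivFin {k // ¬ 2 ≤ (c k).1}
  let G : {k // ¬ 2 ≤ (c k).1} → Embedding R := fun k =>
    { ambient := B k
      finiteLength := hB k
      sub := Submodule.span R {p ^ ((c k).2.2 - (c k).2.1) • b k} }
  refine ⟨Embedding.directSum fun x => G (e.symm x), ⟨_, _, fun x => ⟨_, rfl⟩,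
    LinearEquiv.refl R _, Submodule.map_id _⟩, fun i => ?_⟩
  have key : ∀ k, HasParts (maximalIdeal R) ((G k).ambient ⧸ (maximalIdeal R ^ i • (G k).sub))
      (chainHeights c succ F k i) := by
    intro k
    refine (h k i).congr (Submodule.quotEquivOfEq _ _ ?_)
    have h1 := k.2
    rw [hp.maximalIdeal_eq, Ideal.span_singleton_pow, span_singleton_smul_span_singleton,
      max_eq_left (by omega)]
  have hsum := Embedding.hasParts_directSum (fun x => G (e.symm x)) i fun x => key (e.symm x)
  rw [e.symm.sum_comp fun k => chainHeights c succ F k i,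
    sum_starts_eq (fun k => 2 ≤ (c k).1) hsucc hnone (g := fun k => chainHeights c succ F k i)
      (a := fun k => {columnHeight (c k) i})
      (fun k => by rw [← chainHeights_stable hc hs hF F k i (hfuel k), chainHeights]),
    ← map_univ_val_eq_sum] at hsum
  exact hsum

end LRCyclic

namespace LRCyclic

/-! ### The lattice condition in terms of rows -/

theorem Tableau.mem_boxes {Γ : Tableau} {e i j : ℕ} :
    (i, j) ∈ Γ.boxes e ↔ (i, j) ∈ Γ.diagram e ∧ (i, j) ∉ Γ.diagram (e - 1) := by
  rw [Tableau.boxes, Finset.mem_sdiff, YoungDiagram.mem_cells, YoungDiagram.mem_cells]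

/-- In the first `r` rows there are at most as many entries `e + 1` as there are entries `e` in the
first `r - 1` rows. -/
theorem Tableau.IsLR.card_rows_le {Γ : Tableau} (h : Γ.IsLR) {e : ℕ} (he : 1 ≤ e) (r : ℕ) :
    ((Γ.boxes (e + 1)).filter fun b => b.1 < r + 1).card ≤
      ((Γ.boxes e).filter fun b => b.1 < r).card := by
  rcases ((Γ.boxes (e + 1)).filter fun b => b.1 < r + 1).eq_empty_or_nonempty with h0 | h0
  · rw [h0]
    exact Nat.zero_le _
  obtain ⟨⟨i₀, j₀⟩, hb, hmin⟩ := Finset.exists_min_image _ (fun b => b.2) h0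
  rw [Finset.mem_filter] at hb
  obtain ⟨hb, hi₀⟩ := hb
  simp only at hi₀ hmin
  refine le_trans (Finset.card_le_card fun b hb' => ?_)
    ((h.lattice j₀ e he).trans (Finset.card_le_card ?_))
  · exact Finset.mem_filter.mpr ⟨(Finset.mem_filter.mp hb').1, hmin b hb'⟩
  · rintro ⟨i, j⟩ hb'
    obtain ⟨hb', hj⟩ := Finset.mem_filter.mp hb'
    refine Finset.mem_filter.mpr ⟨hb', ?_⟩
    by_contra! hi
    simp only at hj hi
    refine (Tableau.mem_boxes.mp hb).2 ((Γ.diagram e).up_left_mem ?_ hj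
      (Tableau.mem_boxes.mp hb').1)
    omega

theorem card_cells_filter_row (μ : YoungDiagram) (r : ℕ) :
    (μ.cells.filter fun b => b.1 < r).card = ((parts μ).map (min r)).sum := by
  have hmaps : ∀ b ∈ μ.cells.filter fun b => b.1 < r, b.2 ∈ Finset.range (μ.rowLen 0) := by
    rintro ⟨i, j⟩ hb
    have h1 : (i, j) ∈ μ := (Finset.mem_filter.mp hb).1
    rw [Finset.mem_range, ← YoungDiagram.mem_iff_lt_rowLen]
    exact μ.up_left_mem (Nat.zero_le i) le_rfl h1
  rw [Finset.card_eq_sum_card_fiberwise hmaps, parts, Multiset.map_map]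
  refine Finset.sum_congr rfl fun j _ => ?_
  have h1 : (μ.cells.filter fun b => b.1 < r).filter (fun b => b.2 = j) =
      Finset.range (min r (μ.colLen j)) ×ˢ {j} := by
    ext ⟨i, j'⟩
    simp only [Finset.mem_filter, YoungDiagram.mem_cells, Finset.mem_product, Finset.mem_range,
      Finset.mem_singleton, lt_min_iff, YoungDiagram.mem_iff_lt_colLen]
    constructor
    · rintro ⟨⟨h, h'⟩, rfl⟩
      exact ⟨⟨h', h⟩, rfl⟩
    · rintro ⟨⟨h', h⟩, rfl⟩
      exact ⟨⟨h, h'⟩, rfl⟩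
  rw [h1, Finset.card_product, Finset.card_range, Finset.card_singleton, mul_one]
  rfl

theorem Tableau.card_boxes_filter_row (Γ : Tableau) (e r : ℕ) :
    ((Γ.boxes e).filter fun b => b.1 < r).card + ((parts (Γ.diagram (e - 1))).map (min r)).sum =
      ((parts (Γ.diagram e)).map (min r)).sum := by
  rw [← card_cells_filter_row, ← card_cells_filter_row]
  have hsub : (Γ.diagram (e - 1)).cells.filter (fun b => b.1 < r) ⊆
      (Γ.diagram e).cells.filter fun b => b.1 < r :=
    Finset.filter_subset_filter _ (Γ.mono (Nat.sub_le e 1))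
  rw [← Finset.card_sdiff_add_card_eq_card hsub, Tableau.boxes]
  congr 2
  ext b
  simp only [Finset.mem_filter, Finset.mem_sdiff]
  tauto

theorem sum_map_min_filter (s : Multiset ℕ) (r : ℕ) :
    ((s.filter (· ≠ 0)).map (min r)).sum = (s.map (min r)).sum := by
  induction s using Multiset.induction with
  | empty => rfl
  | cons a s ih =>
    by_cases ha : a ≠ 0
    · rw [Multiset.filter_cons_of_pos (p := (· ≠ 0)) _ ha, Multiset.map_cons, Multiset.map_cons,
        Multiset.sum_cons, Multiset.sum_cons, ih]
    · rw [Multiset.filter_cons_of_neg (p := (· ≠ 0)) _ ha, Multiset.map_cons, Multiset.sum_cons, ih,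
        not_not.mp ha, Nat.min_zero, zero_add]

/-! ### Counting entries by columns and arranging columns in chains -/

section

variable {Γ : Tableau} {ι : Type*} [Fintype ι] {c : ι → ℕ × ℕ × ℕ}

/-- The entries `e` in the first rows, counted by columns. -/
theorem card_boxes_eq_card_columns (hc : ∀ k, IsColumnIndex (c k))
    (hΓ : ∀ i, parts (Γ.diagram i) =
      (Finset.univ.val.map fun k => columnHeight (c k) i).filter (· ≠ 0)) {e : ℕ} (he : 1 ≤ e)
    (r : ℕ) : ((Γ.boxes e).filter fun b => b.1 < r).card =
      (Finset.univ.filter fun k => ((c k).1 ≤ e ∧ e ≤ (c k).2.1) ∧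
        (c k).2.2 + e ≤ r + (c k).2.1).card := by
  have h1 := Γ.card_boxes_filter_row e r
  rw [hΓ, hΓ, sum_map_min_filter, sum_map_min_filter, Multiset.map_map, Multiset.map_map] at h1
  change _ + ∑ k, min r (columnHeight (c k) (e - 1)) = ∑ k, min r (columnHeight (c k) e) at h1
  -- A column grows at time `e` exactly if it contains the entry `e`. The new box lies in row `n - f
  -- + e - 1`, counted from `0`, so it is among the first `r` rows iff `n + e ≤ r + f`.
  have h2 : ∑ k, min r (columnHeight (c k) e) =
      ∑ k, ((if ((c k).1 ≤ e ∧ e ≤ (c k).2.1) ∧ (c k).2.2 + e ≤ r + (c k).2.1 then 1 else 0) +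
        min r (columnHeight (c k) (e - 1))) := by
    refine Finset.sum_congr rfl fun k _ => ?_
    have hk := hc k
    simp only [IsColumnIndex] at hk
    simp only [columnHeight]
    split_ifs <;> omega
  rw [h2, Finset.sum_add_distrib, ← Finset.card_filter] at h1
  exact add_right_cancel h1

/-- In terms of columns, the lattice condition compares the columns which start with `e + 1` with
those which end with `e`. -/
theorem card_start_le_card_end (hLR : Γ.IsLR) (hc : ∀ k, IsColumnIndex (c k))
    (hΓ : ∀ i, parts (Γ.diagram i) =
      (Finset.univ.val.map fun k => columnHeight (c k) i).filter (· ≠ 0)) {e : ℕ} (he : 1 ≤ e)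
    (r : ℕ) :
    (Finset.univ.filter fun k => (c k).1 = e + 1 ∧ (c k).2.2 + e ≤ r + (c k).2.1).card ≤
      (Finset.univ.filter fun k => (c k).2.1 = e ∧ (c k).2.2 + e ≤ r + (c k).2.1).card := by
  classical
  have h := hLR.card_rows_le he r
  rw [card_boxes_eq_card_columns hc hΓ he, card_boxes_eq_card_columns hc hΓ (by omega)] at h
  -- The columns containing both `e` and `e + 1` occur on both sides: passing from `e` to `e + 1`
  -- moves down one row, which matches the bounds `r` and `r + 1`.
  let A := Finset.univ.filter fun k =>
    ((c k).1 ≤ e ∧ e + 1 ≤ (c k).2.1) ∧ (c k).2.2 + e ≤ r + (c k).2.1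
  have h1 : (Finset.univ.filter fun k => ((c k).1 ≤ e + 1 ∧ e + 1 ≤ (c k).2.1) ∧
      (c k).2.2 + (e + 1) ≤ r + 1 + (c k).2.1) = A ∪
      Finset.univ.filter fun k => (c k).1 = e + 1 ∧ (c k).2.2 + e ≤ r + (c k).2.1 := by
    ext k
    have hk := hc k
    simp only [IsColumnIndex] at hk
    simp only [A, Finset.mem_union, Finset.mem_filter, Finset.mem_univ, true_and]
    omega
  have h2 : (Finset.univ.filter fun k => ((c k).1 ≤ e ∧ e ≤ (c k).2.1) ∧
      (c k).2.2 + e ≤ r + (c k).2.1) = A ∪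
      Finset.univ.filter fun k => (c k).2.1 = e ∧ (c k).2.2 + e ≤ r + (c k).2.1 := by
    ext k
    have hk := hc k
    simp only [IsColumnIndex] at hk
    simp only [A, Finset.mem_union, Finset.mem_filter, Finset.mem_univ, true_and]
    omega
  rw [h1, h2, Finset.card_union_of_disjoint, Finset.card_union_of_disjoint] at h
  · exact Nat.le_of_add_le_add_left h
  all_goals
    rw [Finset.disjoint_left]
    intro k
    simp only [A, Finset.mem_filter, Finset.mem_univ, true_and]
    omega

/-- The columns of an LR-tableau can be arranged in chains. -/
theorem exists_pred (hLR : Γ.IsLR) (hc : ∀ k, IsColumnIndex (c k))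
    (hΓ : ∀ i, parts (Γ.diagram i) =
      (Finset.univ.val.map fun k => columnHeight (c k) i).filter (· ≠ 0)) :
    ∃ pred : {k // 2 ≤ (c k).1} → ι, Function.Injective pred ∧ ∀ k, Follows c (pred k) k := by
  classical
  have key : ∀ e, ∃ φ : {k // (c k).1 = e + 2} → ι, Function.Injective φ ∧
      ∀ k : {k // (c k).1 = e + 2}, φ k ∈ Finset.univ.filter fun k' => (c k').2.1 = e + 1 ∧
        (c k').2.2 + (c k).2.1 ≤ (c k).2.2 + (c k').2.1 := by
    intro e
    -- Hall's theorem. The sets of admissible predecessors are nested, growing with `n - f`, so the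
    -- union over `S` is the set of the member with maximal `n - f`. The difference is taken in `ℤ`,
    -- as it may still be negative here.
    rw [← Finset.all_card_le_biUnion_card_iff_exists_injective]
    intro S
    rcases S.eq_empty_or_nonempty with rfl | hS
    · simp
    obtain ⟨k₀, hk₀, hmax⟩ := Finset.exists_max_image S
      (fun k => ((c k).2.2 : ℤ) - (c k).2.1) hS
    have hk := hc k₀
    have hk₂ := k₀.2
    simp only [IsColumnIndex] at hk
    obtain ⟨r, hr⟩ := Nat.exists_eq_add_of_le
      (show (c k₀).2.1 ≤ (c k₀).2.2 + (e + 1) by omega)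
    refine le_trans ?_ ((card_start_le_card_end hLR hc hΓ (Nat.le_add_left 1 e) r).trans
      (Finset.card_le_card fun k' hk' => ?_))
    · rw [← Finset.card_map (Function.Embedding.subtype _)]
      refine Finset.card_le_card fun k hk => ?_
      obtain ⟨x, hx, rfl⟩ := Finset.mem_map.mp hk
      have h1 := hmax x hx
      have h2 := x.2
      simp only [Function.Embedding.subtype_apply, Finset.mem_filter, Finset.mem_univ, true_and]
      omega
    · refine Finset.mem_biUnion.mpr ⟨k₀, hk₀, ?_⟩
      simp only [Finset.mem_filter, Finset.mem_univ, true_and] at hk' ⊢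
      omega
  choose φ hφ hφ' using key
  simp only [Finset.mem_filter, Finset.mem_univ, true_and] at hφ'
  have he : ∀ k : {k // 2 ≤ (c k).1}, (c k).1 = (c k).1 - 2 + 2 := fun k => by
    have := k.2
    omega
  refine ⟨fun k => φ ((c k).1 - 2) ⟨k, he k⟩, fun x y hxy => ?_, fun k => ⟨?_, ?_⟩⟩
  · simp only at hxy
    have hx := (hφ' _ ⟨x, he x⟩).1
    have hy := (hφ' _ ⟨y, he y⟩).1
    -- The last entry of a common predecessor determines `e`, so the matchings for different `e`
    -- have disjoint images.
    have hxy' : ∀ e (hx : (c x).1 = e + 2) e' (hy : (c y).1 = e' + 2), e = e' →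
        φ e ⟨x, hx⟩ = φ e' ⟨y, hy⟩ → x.1 = y.1 := by
      rintro e hx _ hy rfl h
      exact Subtype.mk.inj (hφ e h)
    refine Subtype.ext (hxy' _ (he x) _ (he y) ?_ hxy)
    rw [hxy] at hx
    omega
  · have h1 := (hφ' _ ⟨k, he k⟩).1
    have h2 := he k
    simp only
    omega
  · exact (hφ' _ ⟨k, he k⟩).2

end

end LRCyclic

theorem mainTheorem6 {Λ : Type u} [CommRing Λ] [IsDomain Λ] [IsDiscreteValuationRing Λ]
    (Γ : LRCyclic.Tableau) (hΓ : Γ.IsLR) :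
    (∃ E : LRCyclic.Embedding Λ, E.IsDirectSumOfCyclics ∧ E.HasTableau Γ) ↔
      Γ.IsUnionOfColumns := by
  constructor
  · rintro ⟨E, hE, hΓE⟩
    exact LRCyclic.Embedding.isUnionOfColumns_of_isDirectSumOfCyclics hE hΓE
  · intro h
    obtain ⟨N, c, hc, hparts⟩ := (LRCyclic.isUnionOfColumns_iff Γ).mp h
    obtain ⟨pred, hinj, hpred⟩ := LRCyclic.exists_pred hΓ hc hparts
    obtain ⟨E, hE, hE'⟩ := LRCyclic.exists_embedding_of_pred Λ hc pred hinj hpred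
    exact ⟨E, hE, fun i => (LRCyclic.hasType_iff _).mpr ⟨_, hE' i, (hparts i).symm⟩⟩
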